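/- Let $K$ be a field of characteristic $0$ and let $n\ge 0$ be an integer. For $a,b,c\in K$ put \[P_n(a,b,c)=c\prod_{i=1}^{n-1}\bigl(ia+(n-i)b+c\bigr)\quad(n\ge 1),\qquad P_0(a,b,c)=1 .\] A forest on $[n]=\{1,\dots,n\}$ is a forest of (unordered) rooted trees with vertex set $[n]$. For such a forest $F$ let $\operatorname{tree}F$ be its number of trees and, for $v\in[n]$, let the hook length $h(v)=h_F(v)$ be the number of descendants of $v$ in $F$, including $v$ itself. Then, with sums over all forests $F$ on $[n]$: (i) for all $c,\alpha\in K$, \[\sum_{F} c^{\operatorname{tree}F}\prod_{v\in[n]}\Bigl(1+\frac{\alpha}{h(v)}\Bigr)=P_n\bigl(1,\,1+\alpha,\,c(1+\alpha)\bigr);\] (ii) for all $c\in K$ with $n+c\ne 0$, \[\frac1{n!}\sum_{F} c^{\operatorname{tree}F}\prod_{v\in[n]}\Bigl(1+\frac{1}{h(v)}\Bigr)=\frac1{n!}P_n(1,2,2c)=\frac{c}{n+c}\binom{2n+2c}{n},\] where $\binom{x}{n}=x(x-1)\cdots(x-n+1)/n!$; (iii) in particular, for $c=1$, \[\frac1{n!}\sum_{F}\prod_{v\in[n]}\Bigl(1+\frac1{h(v)}\Bigr)=C_{n+1},\]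 where $C_m=\frac1{m+1}\binom{2m}{m}$ is the $m$-th Catalan number. -/

import Mathlib

/-- A forest of rooted trees with vertex set `V`: every vertex has a parent (`some u`) or is a
root (`none`), and passing from a vertex to its parent always stops at a root after finitely many
steps (for finite `V`: there are no directed cycles). -/
@[ext]
structure RootedForest (V : Type*) where
  parent : V → Option V
  wf : WellFounded (fun u v => parent v = some u)

namespace RootedForest

noncomputable instance {V : Type*} [Fintype V] : Fintype (RootedForest V) := by
  classical
  exact Fintype.ofInjective RootedForest.parent (fun _ _ h => RootedForest.ext h)

/-- `v` is a descendant of `u`: `u` lies on the path from the root of the tree of `v` to `v`.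
Each vertex is a descendant of itself. -/
def IsDescendant {V : Type*} (F : RootedForest V) (u v : V) : Prop :=
  Relation.ReflTransGen (fun x y => F.parent y = some x) u v

/-- The hook length `h(v)`: the number of descendants of `v`, including `v`. -/
noncomputable def hook {V : Type*} (F : RootedForest V) (v : V) : ℕ :=
  {w | F.IsDescendant v w}.ncard

/-- The number of trees of the forest; each tree has exactly one root, so this is the number of
roots. -/
noncomputable def tree {V : Type*} (F : RootedForest V) : ℕ :=
  {v | F.parent v = none}.ncard

end RootedForest

/-- `P_n(a,b,c) = c ∏_{i=1}^{n-1} (i a + (n-i) b + c)` for `n ≥ 1`, and `P_0(a,b,c) = 1`. -/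
def forestPoly {R : Type*} [CommRing R] (n : ℕ) (a b c : R) : R :=
  if n = 0 then 1
  else c * ∏ i ∈ Finset.Icc 1 (n - 1), ((i : R) * a + ((n : R) - (i : R)) * b + c)

/-! The hook lengths of the roots of a forest on `n` vertices add up to `n` (`sum_root_hook`), so
`n` times the weighted sum is a sum over pairs of a forest and a root `r`, weighted by `h(r)`. For
fixed `r`, splitting off the set `A` of proper descendants of `r` leaves a forest on `A` and one on
the remaining vertices (`join`, `restrict`). The factor `h(r)(1 + α/h(r)) = |A| + 1 + α` is no
longer a fraction, and by induction the sum over `A` is a binomial convolution of forest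
polynomials, the same for every `r`.

That this convolution is again a forest polynomial (`forestPoly_recurrence`) follows from the
Hagen–Rothe type identity `forestProd_add`. Both of its sides are polynomials in `y`. By induction
their difference has period `b - a`, and it vanishes at one well-chosen point, hence identically if
`a ≠ b`. -/

/-- `∏_{i=0}^{k-1} (i a + (k-i) b + y)`. -/
def forestProd {R : Type*} [CommRing R] (k : ℕ) (a b y : R) : R :=
  ∏ i ∈ Finset.range k, ((i : R) * a + ((k : R) - (i : R)) * b + y)

/-! ### Product identities and the Hagen–Rothe type convolution -/

section ForestProd

variable {R S : Type*} [CommRing R] [CommRing S]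

@[simp]
lemma forestProd_zero (a b y : R) : forestProd 0 a b y = 1 := by simp [forestProd]

@[simp]
lemma forestPoly_zero (a b x : R) : forestPoly 0 a b x = 1 := by simp [forestPoly]

lemma forestPoly_succ (m : ℕ) (a b x : R) :
    forestPoly (m + 1) a b x = x * forestProd m a b (a + x) := by
  simp only [forestPoly, Nat.add_one_ne_zero, if_false, Nat.add_sub_cancel, forestProd]
  rw [← Finset.Ico_add_one_right_eq_Icc, Finset.prod_Ico_eq_prod_range]
  congr 1
  refine Finset.prod_congr (by simp) fun i _ => ?_
  push_cast
  ring

lemma forestProd_succ_bot (k : ℕ) (a b y : R) :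
    forestProd (k + 1) a b y = (((k : R) + 1) * b + y) * forestProd k a b (a + y) := by
  rw [forestProd, Finset.prod_range_succ', forestProd, mul_comm]
  congr 1
  · push_cast; ring
  · refine Finset.prod_congr rfl fun i _ => ?_
    push_cast; ring

lemma forestProd_succ_top (k : ℕ) (a b y : R) :
    forestProd (k + 1) a b y = ((k : R) * a + b + y) * forestProd k a b (b + y) := by
  rw [forestProd, Finset.prod_range_succ, forestProd, mul_comm]
  congr 1
  · push_cast; ring
  · refine Finset.prod_congr rfl fun i _ => ?_
    push_cast; ring

lemma map_forestProd (φ : R →+* S) (k : ℕ) (a b y : R) :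
    φ (forestProd k a b y) = forestProd k (φ a) (φ b) (φ y) := by
  simp [forestProd, map_prod]

lemma map_forestPoly (φ : R →+* S) (k : ℕ) (a b y : R) :
    φ (forestPoly k a b y) = forestPoly k (φ a) (φ b) (φ y) := by
  cases k <;> simp [forestPoly_succ, map_forestProd]

/-- The two products share all factors but one: drop the bottom factor of the first and the top
factor of the second. -/
lemma forestProd_sub_shift (k : ℕ) (a b y : R) :
    forestProd (k + 1) a b (y + (b - a)) - forestProd (k + 1) a b y =
      ((k : R) + 1) * (b - a) * forestProd k a b (b + y) := by
  rw [forestProd_succ_bot, forestProd_succ_top, show a + (y + (b - a)) = b + y by ring]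
  ring

/-- This is an `m`-th finite difference at `0` of a polynomial of degree below `m`. -/
lemma alternating_sum_eval_eq_zero {m : ℕ} {q : Polynomial R} (hq : q.natDegree < m) :
    ∑ p ∈ Finset.HasAntidiagonal.antidiagonal m, (m.choose p.1 : R) * ((-1) ^ p.1 * q.eval (p.2 : R)) = 0 := by
  have h := congrFun (Polynomial.fwdDiff_iter_eq_zero_of_degree_lt hq) 0
  rw [fwdDiff_iter_eq_sum_shift] at h
  rw [← Finset.Nat.sum_antidiagonal_swap,
    Finset.Nat.sum_antidiagonal_eq_sum_range_succ_mk]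
  simp only [Prod.swap_prod_mk]
  refine Eq.trans (Finset.sum_congr rfl fun k hk => ?_) h
  rw [Nat.choose_symm (Nat.lt_succ_iff.mp (Finset.mem_range.mp hk))]
  simp [zsmul_eq_mul]
  ring

/-- At this value of `y` the factors of both products interlock into one progression of step `b -
a`. For fixed `k + j` the result, up to sign, is a polynomial in `j` of degree less than `k + j`. -/
lemma forestProd_mul_forestPoly_eq (k j : ℕ) (hkj : 0 < k + j) (a b x : R) :
    forestProd k a b (-x - ((k + j : ℕ) : R) * b) * forestPoly j a b x =
      (-1) ^ k * (x * ∏ s ∈ Finset.range (k + j - 1), (x + (j : R) * a + ((s : R) + 1) * (b - a))) := by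
  have h1 : forestProd k a b (-x - ((k + j : ℕ) : R) * b) =
      (-1) ^ k * ∏ i ∈ Finset.range k, (x + (j : R) * b + (i : R) * (b - a)) := by
    rw [forestProd, ← Finset.card_range k, ← Finset.prod_const, Finset.card_range,
      ← Finset.prod_mul_distrib]
    refine Finset.prod_congr rfl fun i _ => ?_
    push_cast; ring
  rw [h1, mul_assoc]
  congr 1
  cases j with
  | zero =>
    -- Since `P_0 = 1` lacks the factor `x`, it must come from the term `i = 0` of the other
    -- product.
    obtain ⟨k, rfl⟩ := Nat.exists_eq_succ_of_ne_zero (by omega : k ≠ 0)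
    rw [Finset.prod_range_succ']
    simp
    ring
  | succ j =>
    rw [forestPoly_succ, show k + (j + 1) - 1 = j + k by omega, Finset.prod_range_add,
      forestProd, ← Finset.prod_range_reflect _ j, mul_comm, mul_assoc]
    congr 2
    · refine Finset.prod_congr rfl fun i hi => ?_
      have hi := Finset.mem_range.mp hi
      obtain ⟨d, rfl⟩ := Nat.exists_eq_add_of_lt hi
      rw [show i + d + 1 - 1 - i = d by omega]
      push_cast; ring
    · refine Finset.prod_congr rfl fun i hi => ?_
      push_cast; ring

lemma sum_forestProd_mul_forestPoly_base {m : ℕ} (hm : 0 < m) (a b x : R) :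
    ∑ p ∈ Finset.HasAntidiagonal.antidiagonal m, (m.choose p.1 : R) *
      (forestProd p.1 a b (-x - (m : R) * b) * forestPoly p.2 a b x) = 0 := by
  let q : Polynomial R := Polynomial.C x * ∏ s ∈ Finset.range (m - 1),
    (Polynomial.X * Polynomial.C a + Polynomial.C (x + ((s : R) + 1) * (b - a)))
  have hq : q.natDegree < m := by
    have h1 : q.natDegree ≤ m - 1 := by
      refine (Polynomial.natDegree_C_mul_le _ _).trans ((Polynomial.natDegree_prod_le _ _).trans ?_)
      refine (Finset.sum_le_card_nsmul _ _ 1 fun s _ => ?_).trans (by simp)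
      compute_degree
    omega
  refine Eq.trans (Finset.sum_congr rfl fun p hp => ?_) (alternating_sum_eval_eq_zero hq)
  obtain rfl := Finset.HasAntidiagonal.mem_antidiagonal.mp hp
  rw [forestProd_mul_forestPoly_eq _ _ hm]
  simp only [q, Polynomial.eval_mul, Polynomial.eval_C, Polynomial.eval_prod, Polynomial.eval_add,
    Polynomial.eval_X]
  congr 3
  refine Finset.prod_congr rfl fun i hi => ?_
  ring

lemma forestProd_add_of_ne [IsDomain R] [CharZero R] {a b : R} (hab : b - a ≠ 0) (m : ℕ)
    (x y : R) :
    forestProd m a b (x + y) = ∑ p ∈ Finset.HasAntidiagonal.antidiagonal m, (m.choose p.1 : R) *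
      (forestProd p.1 a b y * forestPoly p.2 a b x) := by
  induction m generalizing y with
  | zero => simp
  | succ m ih =>
    let f (y : R) : R := forestProd (m + 1) a b (x + y) -
      ∑ p ∈ Finset.HasAntidiagonal.antidiagonal (m + 1), ((m + 1).choose p.1 : R) *
        (forestProd p.1 a b y * forestPoly p.2 a b x)
    have hper (y : R) : f (y + (b - a)) = f y := by
      rw [← sub_eq_zero]
      simp only [f]
      rw [sub_sub_sub_comm, ← Finset.sum_sub_distrib, ← add_assoc, forestProd_sub_shift,
        Finset.Nat.sum_antidiagonal_succ, show b + (x + y) = x + (b + y) by ring, ih,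
        Finset.mul_sum, sub_eq_zero]
      simp only [forestProd_zero, sub_self, zero_add]
      refine Finset.sum_congr rfl fun p _ => ?_
      have h := congrArg (Nat.cast (R := R)) (Nat.add_one_mul_choose_eq m p.1)
      push_cast at h
      have h2 := forestProd_sub_shift p.1 a b y
      linear_combination (b - a) * forestProd p.1 a b (b + y) * forestPoly p.2 a b x * h -
        ((m + 1).choose (p.1 + 1) : R) * forestPoly p.2 a b x * h2
    have hbase : f (-x - ((m + 1 : ℕ) : R) * b) = 0 := by
      simp only [f]
      -- The bottom factor `(m + 1) b + x + y` vanishes at this `y`.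
      rw [sum_forestProd_mul_forestPoly_base m.succ_pos, forestProd_succ_bot]
      push_cast; ring
    have hmul (n : ℕ) : f (-x - ((m + 1 : ℕ) : R) * b + n * (b - a)) = 0 := by
      induction n with
      | zero => simpa using hbase
      | succ n ihn =>
        rw [← ihn, ← hper (_ + n * _), Nat.cast_add_one n, add_one_mul (n : R), add_assoc]
    let F : Polynomial R :=
      forestProd (m + 1) (.C a) (.C b) (.C x + .X) -
      ∑ p ∈ Finset.HasAntidiagonal.antidiagonal (m + 1), ((m + 1).choose p.1 : Polynomial R) *
        (forestProd p.1 (.C a) (.C b) .X * forestPoly p.2 (.C a) (.C b) (.C x))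
    have hF (y : R) : F.eval y = f y := by
      simp only [F, f, ← Polynomial.coe_evalRingHom, map_sub, map_sum, map_mul, map_forestProd,
        map_forestPoly, map_natCast]
      simp
    have hF0 : F = 0 := by
      refine Polynomial.eq_zero_of_infinite_isRoot _ (Set.infinite_of_injective_forall_mem
        (f := fun n : ℕ => -x - ((m + 1 : ℕ) : R) * b + n * (b - a)) ?_ fun n => ?_)
      · intro n n' h
        simpa [hab] using h
      · exact (hF _).trans (hmul n)
    have := hF y
    rw [hF0, Polynomial.eval_zero] at this
    exact sub_eq_zero.mp this.symm

/-- A Hagen–Rothe type convolution identity. -/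
theorem forestProd_add [IsDomain R] [CharZero R] (m : ℕ) (a b x y : R) :
    forestProd m a b (x + y) = ∑ p ∈ Finset.HasAntidiagonal.antidiagonal m, (m.choose p.1 : R) *
      (forestProd p.1 a b y * forestPoly p.2 a b x) := by
  -- To include `a = b`, take `b` to be an indeterminate and then specialize.
  have h := congrArg (Polynomial.evalRingHom b) (forestProd_add_of_ne
    (Polynomial.X_sub_C_ne_zero a) m (.C x) (.C y))
  simp only [map_sum, map_mul, map_forestProd, map_forestPoly, map_add, map_natCast] at h
  simpa using h

theorem forestPoly_recurrence [IsDomain R] [CharZero R] (m : ℕ) (c α : R) :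
    forestPoly (m + 1) 1 (1 + α) (c * (1 + α)) =
      ∑ p ∈ Finset.HasAntidiagonal.antidiagonal m, (m.choose p.1 : R) * (c * ((p.1 : R) + 1 + α) *
        (forestPoly p.1 1 (1 + α) (1 + α) * forestPoly p.2 1 (1 + α) (c * (1 + α)))) := by
  rw [forestPoly_succ, add_comm 1 (c * _), forestProd_add, Finset.mul_sum]
  refine Finset.sum_congr rfl fun p _ => ?_
  have h : (1 + α) * forestProd p.1 1 (1 + α) 1 =
      ((p.1 : R) + 1 + α) * forestPoly p.1 1 (1 + α) (1 + α) := by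
    rcases p.1 with _ | k
    · simp
    · rw [forestProd_succ_top, forestPoly_succ, add_comm (1 + α) 1]
      push_cast; ring
  linear_combination (m.choose p.1 : R) * c * forestPoly p.2 1 (1 + α) (c * (1 + α)) * h

end ForestProd

/-! ### Binomial and Catalan evaluations -/

lemma forestPoly_one_two {K : Type*} [Field K] [CharZero K] (n : ℕ) {c : K} (hc : (n : K) + c ≠ 0) :
    1 / (n.factorial : K) * forestPoly n 1 2 (2 * c) =
      c / ((n : K) + c) * Ring.choose (2 * (n : K) + 2 * c) n := by
  have hn : (n.factorial : K) ≠ 0 := by exact_mod_cast n.factorial_ne_zero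
  have h := Ring.descPochhammer_eq_factorial_smul_choose (2 * (n : K) + 2 * c) n
  rw [← Polynomial.aeval_eq_smeval, Polynomial.aeval_def, ← Polynomial.eval_map,
    descPochhammer_map, descPochhammer_eval_eq_prod_range, nsmul_eq_mul] at h
  -- Multiplying by `n + c` supplies the missing factor `i = 0` of the falling factorial, up to a 2
  -- taken from `2 * c`.
  have h2 : forestPoly n 1 2 (2 * c) * (n + c) =
      c * ∏ i ∈ Finset.range n, (2 * (n : K) + 2 * c - i) := by
    rcases n with _ | m
    · simp
    · rw [forestPoly_succ, forestProd, Finset.prod_range_succ']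
      have : ∀ i ∈ Finset.range m, (i : K) * 1 + ((m : K) - i) * 2 + (1 + 2 * c) =
          2 * ((m + 1 : ℕ) : K) + 2 * c - ((i + 1 : ℕ) : K) := fun i _ => by push_cast; ring
      rw [Finset.prod_congr rfl this]
      push_cast; ring
  rw [h] at h2
  rw [div_mul_eq_mul_div, div_mul_eq_mul_div, div_eq_div_iff hn hc]
  linear_combination h2

lemma choose_div_eq_catalan {K : Type*} [Field K] [CharZero K] (n : ℕ) :
    1 / ((n : K) + 1) * ((2 * n + 2).choose n : K) = (catalan (n + 1) : K) := by
  have h1 := Nat.choose_succ_right_eq (2 * n + 2) n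
  have h2 := succ_mul_catalan_eq_centralBinom (n + 1)
  rw [Nat.centralBinom_eq_two_mul_choose, mul_add, mul_one] at h2
  rw [← h2, show 2 * n + 2 - n = n + 2 by omega] at h1
  have h3 : catalan (n + 1) * (n + 1) = (2 * n + 2).choose n :=
    Nat.eq_of_mul_eq_mul_right (by omega : 0 < n + 2) (by rw [← h1]; ring)
  have : (n : K) + 1 ≠ 0 := by exact_mod_cast n.succ_ne_zero
  rw [← h3]
  push_cast
  field_simp

/-! ### Decomposition of a forest at a root -/

namespace RootedForest

variable {V : Type*}

lemma existsUnique_root (F : RootedForest V) (v : V) :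
    ∃! r, F.parent r = none ∧ F.IsDescendant r v := by
  induction v using F.wf.induction with
  | _ v ih =>
    cases h : F.parent v with
    | none =>
      refine ⟨v, ⟨h, .refl⟩, fun r hr => ?_⟩
      rcases hr.2.cases_tail with h' | ⟨u, _, hu⟩
      · exact h'.symm
      · simp [h] at hu
    | some u =>
      obtain ⟨r, hr, huniq⟩ := ih u h
      refine ⟨r, ⟨hr.1, hr.2.tail h⟩, fun s hs => huniq s ⟨hs.1, ?_⟩⟩
      rcases hs.2.cases_tail with h' | ⟨u', hu', hu⟩
      · rw [h'] at h
        simp [hs.1] at h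
      · rw [h, Option.some_inj] at hu
        exact hu ▸ hu'

/-- The restriction of a forest to a set of vertices: a vertex whose parent is removed becomes a
root. -/
noncomputable def restrict (F : RootedForest V) (A : Finset V) : RootedForest A where
  parent v := open Classical in
    (F.parent v).bind fun u => if h : u ∈ A then some ⟨u, h⟩ else none
  wf := by
    refine Subrelation.wf (r := InvImage (fun u v => F.parent v = some u) Subtype.val) ?_
      (InvImage.wf _ F.wf)
    intro u v h
    obtain ⟨w, hw, h⟩ := Option.bind_eq_some_iff.mp h
    split_ifs at h with hA
    simp only [Option.some_inj] at h
    simpa [InvImage, ← h] using hw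

section Join

variable [DecidableEq V]

/-- The parent function of the forest on `V` obtained from a forest on `A` by adding a common root
`r`, together with a forest on the remaining vertices. -/
def joinParent (r : V) (A B : Finset V) (G : RootedForest A) (H : RootedForest B) (v : V) :
    Option V :=
  if hA : v ∈ A then some ((G.parent ⟨v, hA⟩).elim r Subtype.val)
  else if hB : v ∈ B then (H.parent ⟨v, hB⟩).map Subtype.val
  else none

variable {r : V} {A B : Finset V} {G : RootedForest A} {H : RootedForest B}

lemma joinParent_left {v : V} (hv : v ∈ A) :
    joinParent r A B G H v = some ((G.parent ⟨v, hv⟩).elim r Subtype.val) := by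
  simp [joinParent, hv]

lemma joinParent_right (hAB : Disjoint A B) {v : V} (hv : v ∈ B) :
    joinParent r A B G H v = (H.parent ⟨v, hv⟩).map Subtype.val := by
  simp [joinParent, hv, Finset.disjoint_right.mp hAB hv]

lemma joinParent_of_notMem {v : V} (hA : v ∉ A) (hB : v ∉ B) :
    joinParent r A B G H v = none := by
  simp [joinParent, hA, hB]

lemma joinParent_wellFounded (hrA : r ∉ A) (hrB : r ∉ B) (hAB : Disjoint A B) :
    WellFounded fun u v => joinParent r A B G H v = some u := by
  have hout (v : V) (hA : v ∉ A) (hB : v ∉ B) :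
      Acc (fun u v => joinParent r A B G H v = some u) v :=
    ⟨_, fun u hu => by simp [joinParent_of_notMem hA hB] at hu⟩
  have hleft (v : A) : Acc (fun u v => joinParent r A B G H v = some u) v.1 := by
    induction v using G.wf.induction with
    | _ v ih =>
      refine ⟨_, fun u hu => ?_⟩
      rw [joinParent_left v.2, Option.some_inj] at hu
      cases h : G.parent v with
      | none => simp only [h, Option.elim_none] at hu; exact hu ▸ hout r hrA hrB
      | some w => simp only [h, Option.elim_some] at hu; exact hu ▸ ih w h
  have hright (v : B) : Acc (fun u v => joinParent r A B G H v = some u) v.1 := by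
    induction v using H.wf.induction with
    | _ v ih =>
      refine ⟨_, fun u hu => ?_⟩
      rw [joinParent_right hAB v.2] at hu
      obtain ⟨w, hw, rfl⟩ := Option.map_eq_some_iff.mp hu
      exact ih w hw
  refine ⟨fun v => ?_⟩
  by_cases hA : v ∈ A
  · exact hleft ⟨v, hA⟩
  by_cases hB : v ∈ B
  · exact hright ⟨v, hB⟩
  · exact hout v hA hB

/-- The forest consisting of the tree with root `r` over the forest `G`, and of the forest `H`. -/
def join (r : V) (A B : Finset V) (hrA : r ∉ A) (hrB : r ∉ B) (hAB : Disjoint A B)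
    (G : RootedForest A) (H : RootedForest B) : RootedForest V where
  parent := joinParent r A B G H
  wf := joinParent_wellFounded hrA hrB hAB

variable {hrA : r ∉ A} {hrB : r ∉ B} {hAB : Disjoint A B}

lemma join_parent_left {v : V} (hv : v ∈ A) :
    (join r A B hrA hrB hAB G H).parent v = some ((G.parent ⟨v, hv⟩).elim r Subtype.val) :=
  joinParent_left hv

lemma join_parent_right {v : V} (hv : v ∈ B) :
    (join r A B hrA hrB hAB G H).parent v = (H.parent ⟨v, hv⟩).map Subtype.val :=
  joinParent_right hAB hv

lemma join_parent_root : (join r A B hrA hrB hAB G H).parent r = none :=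
  joinParent_of_notMem hrA hrB

lemma join_isDescendant_left (v : A) (w : V) :
    (join r A B hrA hrB hAB G H).IsDescendant v w ↔ ∃ h : w ∈ A, G.IsDescendant v ⟨w, h⟩ := by
  constructor
  · intro h
    induction h with
    | refl => exact ⟨v.2, .refl⟩
    | @tail x y _ hxy ih =>
      obtain ⟨hx, ih⟩ := ih
      by_cases hA : y ∈ A
      · rw [join_parent_left hA, Option.some_inj] at hxy
        refine ⟨hA, ih.tail ?_⟩
        cases h : G.parent ⟨y, hA⟩ with
        | none => simp only [h, Option.elim_none] at hxy; exact absurd (hxy ▸ hx) hrA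
        | some w => simp only [h, Option.elim_some] at hxy; simp [← hxy]
      by_cases hB : y ∈ B
      · rw [join_parent_right hB] at hxy
        obtain ⟨w, -, rfl⟩ := Option.map_eq_some_iff.mp hxy
        exact absurd w.2 (Finset.disjoint_left.mp hAB hx)
      · simp [join, joinParent_of_notMem hA hB] at hxy
  · rintro ⟨hw, h⟩
    refine Relation.ReflTransGen.lift Subtype.val (fun x y hxy => ?_) v ⟨w, hw⟩ h
    exact (join_parent_left y.2).trans (by simp [hxy])

lemma join_isDescendant_right (v : B) (w : V) :
    (join r A B hrA hrB hAB G H).IsDescendant v w ↔ ∃ h : w ∈ B, H.IsDescendant v ⟨w, h⟩ := by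
  constructor
  · intro h
    induction h with
    | refl => exact ⟨v.2, .refl⟩
    | @tail x y _ hxy ih =>
      obtain ⟨hx, ih⟩ := ih
      by_cases hA : y ∈ A
      · rw [join_parent_left hA, Option.some_inj] at hxy
        cases h : G.parent ⟨y, hA⟩ with
        | none => simp only [h, Option.elim_none] at hxy; exact absurd (hxy ▸ hx) hrB
        | some w =>
          simp only [h, Option.elim_some] at hxy
          exact absurd (hxy ▸ hx) (Finset.disjoint_left.mp hAB w.2)
      by_cases hB : y ∈ B
      · rw [join_parent_right hB] at hxy
        obtain ⟨w, hw, rfl⟩ := Option.map_eq_some_iff.mp hxy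
        exact ⟨hB, ih.tail hw⟩
      · simp [join, joinParent_of_notMem hA hB] at hxy
  · rintro ⟨hw, h⟩
    refine Relation.ReflTransGen.lift Subtype.val (fun x y hxy => ?_) v ⟨w, hw⟩ h
    exact (join_parent_right y.2).trans (by simp [hxy])

lemma join_isDescendant_root (w : V) :
    (join r A B hrA hrB hAB G H).IsDescendant r w ↔ w ∈ insert r A := by
  rw [Finset.mem_insert]
  constructor
  · intro h
    induction h with
    | refl => exact .inl rfl
    | @tail x y _ hxy ih =>
      by_contra! hy
      by_cases hB : y ∈ B
      · rw [join_parent_right hB] at hxy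
        obtain ⟨w, -, rfl⟩ := Option.map_eq_some_iff.mp hxy
        rcases ih with h | h
        · exact hrB (h ▸ w.2)
        · exact Finset.disjoint_left.mp hAB h w.2
      · simp [join, joinParent_of_notMem hy.2 hB] at hxy
  · rintro (rfl | hw)
    · exact .refl
    · suffices ∀ w : A, (join r A B hrA hrB hAB G H).IsDescendant r w from this ⟨w, hw⟩
      intro w
      induction w using G.wf.induction with
      | _ w ih =>
        have hp := join_parent_left (G := G) (H := H) (hrA := hrA) (hrB := hrB) (hAB := hAB) w.2
        cases h : G.parent w with
        | none => exact .single (by simpa [h] using hp)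
        | some u => exact (ih u h).tail (by simpa [h] using hp)

lemma hook_join_left (v : A) : (join r A B hrA hrB hAB G H).hook v = G.hook v := by
  rw [hook, hook, ← Set.ncard_image_of_injective _ Subtype.val_injective]
  congr 1
  ext w
  simp [join_isDescendant_left]

lemma hook_join_right (v : B) : (join r A B hrA hrB hAB G H).hook v = H.hook v := by
  rw [hook, hook, ← Set.ncard_image_of_injective _ Subtype.val_injective]
  congr 1
  ext w
  simp [join_isDescendant_right]

lemma hook_join_root : (join r A B hrA hrB hAB G H).hook r = A.card + 1 := by
  rw [hook, ← Finset.card_insert_of_notMem hrA, ← Set.ncard_coe_finset]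
  congr 1
  ext w
  simp [join_isDescendant_root]

lemma tree_join (hV : ∀ v, v = r ∨ v ∈ A ∨ v ∈ B) :
    (join r A B hrA hrB hAB G H).tree = H.tree + 1 := by
  rw [tree, tree, ← Set.ncard_image_of_injective _ Subtype.val_injective,
    ← Set.ncard_insert_of_notMem (a := r) (by simp [hrB]) (Set.toFinite _)]
  congr 1
  ext v
  rcases hV v with rfl | hv | hv
  · simp [join_parent_root]
  · have h1 : v ≠ r := fun h => hrA (h ▸ hv)
    simp [join_parent_left hv, h1, Finset.disjoint_left.mp hAB hv]
  · have h1 : v ≠ r := fun h => hrB (h ▸ hv)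
    simp [join_parent_right hv, h1, hv]

lemma restrict_join_left : (join r A B hrA hrB hAB G H).restrict A = G := by
  ext1
  funext v
  cases h : G.parent v <;> simp [restrict, join_parent_left v.2, h, hrA]

lemma restrict_join_right : (join r A B hrA hrB hAB G H).restrict B = H := by
  ext1
  funext v
  cases h : H.parent v <;> simp [restrict, join_parent_right v.2, h]

lemma join_restrict (F : RootedForest V) (hV : ∀ v, v = r ∨ v ∈ A ∨ v ∈ B)
    (hr : F.parent r = none) (hdesc : ∀ w, F.IsDescendant r w ↔ w ∈ insert r A) :
    join r A B hrA hrB hAB (F.restrict A) (F.restrict B) = F := by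
  ext1
  funext v
  rcases hV v with rfl | hv | hv
  · rw [join_parent_root, hr]
  · rw [join_parent_left hv]
    rcases ((hdesc v).mpr (Finset.mem_insert_of_mem hv)).cases_tail with h | ⟨u, hu, huv⟩
    · exact absurd (h ▸ hv) hrA
    · rcases Finset.mem_insert.mp ((hdesc u).mp hu) with rfl | huA
      · simp [restrict, huv, hrA]
      · simp [restrict, huv, huA]
  · rw [join_parent_right hv]
    cases h : F.parent v with
    | none => simp [restrict, h]
    | some u =>
      -- If the parent were `r` or a descendant of `r`, so would be `v`.
      have hu : u ∈ B := by
        have hu : u ∉ insert r A := fun hu => by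
          have := (hdesc v).mp (((hdesc u).mpr hu).tail h)
          rcases Finset.mem_insert.mp this with rfl | hvA
          · exact hrB hv
          · exact Finset.disjoint_left.mp hAB hvA hv
        rw [Finset.mem_insert, not_or] at hu
        exact ((hV u).resolve_left hu.1).resolve_left hu.2
      simp [restrict, h, hu]

end Join

/-! ### Weighted sums over forests -/

section HookSum

variable [Fintype V] {K : Type*} [Field K]

/-- The weight of a forest in the hook length formula. -/
noncomputable def hookWeight (c α : K) (F : RootedForest V) : K :=
  c ^ F.tree * ∏ v : V, (1 + α / (F.hook v : K))

lemma sum_root_hook (F : RootedForest V) :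
    ∑ r : V, (if F.parent r = none then F.hook r else 0) = Fintype.card V := by
  classical
  have h (r : V) : (if F.parent r = none then F.hook r else 0) =
      ∑ v : V, if F.parent r = none ∧ F.IsDescendant r v then 1 else 0 := by
    rw [hook, Set.ncard_eq_toFinset_card']
    split_ifs with hr <;> simp [hr]
  rw [Finset.sum_congr rfl fun r _ => h r, Finset.sum_comm]
  have h1 (v : V) :
      ∑ r : V, (if F.parent r = none ∧ F.IsDescendant r v then 1 else 0) = 1 := by
    obtain ⟨r, hr, huniq⟩ := F.existsUnique_root v
    rw [Finset.sum_eq_single_of_mem r (Finset.mem_univ r), if_pos hr]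
    exact fun s _ hs => if_neg fun h => hs (huniq s h)
  simp [h1]

variable [DecidableEq V]

/-- The roots of `G` become children of `r` and no longer count as trees, so `G` enters with `c =
1`. -/
lemma hookWeight_join {r : V} {A B : Finset V} {hrA : r ∉ A} {hrB : r ∉ B} {hAB : Disjoint A B}
    (hV : ∀ v, v = r ∨ v ∈ A ∨ v ∈ B) (G : RootedForest A) (H : RootedForest B) (c α : K) :
    hookWeight c α (join r A B hrA hrB hAB G H) =
      c * (1 + α / ((A.card : K) + 1)) * (hookWeight 1 α G * hookWeight c α H) := by
  have huniv : (Finset.univ : Finset V) = insert r (A ∪ B) := by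
    ext v; simpa using hV v
  rw [hookWeight, huniv, Finset.prod_insert (by simp [hrA, hrB]), Finset.prod_union hAB,
    ← Finset.prod_coe_sort A, ← Finset.prod_coe_sort B, tree_join hV, hook_join_root]
  simp only [hook_join_left, hook_join_right, hookWeight]
  push_cast
  ring

/-- The sum over the forests having `r` as a root with `A` as the set of its proper descendants. -/
lemma sum_hookWeight_fixed (c α : K) {r : V} {A : Finset V} (hrA : r ∉ A) [DecidablePred
    fun F : RootedForest V => F.parent r = none ∧ ∀ w, F.IsDescendant r w ↔ w ∈ insert r A] :
    ∑ F : RootedForest V with F.parent r = none ∧ ∀ w, F.IsDescendant r w ↔ w ∈ insert r A,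
        hookWeight c α F =
      c * (1 + α / ((A.card : K) + 1)) * ((∑ G : RootedForest A, hookWeight 1 α G) *
        ∑ H : RootedForest ((insert r A)ᶜ : Finset V), hookWeight c α H) := by
  have hrB : r ∉ (insert r A)ᶜ := by simp
  have hAB : Disjoint A (insert r A)ᶜ :=
    Finset.disjoint_left.mpr fun v hv => by simp [hv]
  have hV (v : V) : v = r ∨ v ∈ A ∨ v ∈ (insert r A)ᶜ := by
    simp only [Finset.mem_compl, Finset.mem_insert]; tauto
  rw [Finset.sum_mul_sum, ← Finset.sum_product', Finset.mul_sum]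
  symm
  refine Finset.sum_bij' (fun p _ => join r A _ hrA hrB hAB p.1 p.2)
    (fun F _ => (F.restrict A, F.restrict _)) ?_ ?_ ?_ ?_ ?_
  · intro p _
    simpa only [Finset.mem_filter, Finset.mem_univ, true_and] using
      ⟨join_parent_root, join_isDescendant_root⟩
  · simp
  · intro p _
    simp only [restrict_join_left, restrict_join_right]
  · intro F hF
    rw [Finset.mem_filter] at hF
    exact join_restrict F hV hF.2.1 hF.2.2
  · intro p _
    exact (hookWeight_join hV p.1 p.2 c α).symm

lemma sum_root_hookWeight (c α : K) (r : V) :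
    ∑ F : RootedForest V with F.parent r = none, (F.hook r : K) * hookWeight c α F =
      ∑ A ∈ (Finset.univ.erase r).powerset, ((A.card : K) + 1) *
        (c * (1 + α / ((A.card : K) + 1)) * ((∑ G : RootedForest A, hookWeight 1 α G) *
        ∑ H : RootedForest ((insert r A)ᶜ : Finset V), hookWeight c α H)) := by
  classical
  rw [← Finset.sum_fiberwise_of_maps_to
    (g := fun F : RootedForest V => ({w | F.IsDescendant r w ∧ w ≠ r} : Finset V))
    (t := (Finset.univ.erase r).powerset) (fun F _ => by
      rw [Finset.mem_powerset]; intro w; simp)]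
  refine Finset.sum_congr rfl fun A hA => ?_
  have hrA : r ∉ A := fun h => by simpa using Finset.mem_powerset.mp hA h
  rw [← sum_hookWeight_fixed c α hrA, Finset.mul_sum, Finset.filter_filter]
  have hiff (F : RootedForest V) : ({w | F.IsDescendant r w ∧ w ≠ r} : Finset V) = A ↔
      ∀ w, F.IsDescendant r w ↔ w ∈ insert r A := by
    rw [Finset.ext_iff]
    refine forall_congr' fun w => ?_
    by_cases hw : w = r
    · subst hw
      have : F.IsDescendant w w := .refl
      simp [hrA, this]
    · simp [hw]
  simp only [hiff]
  refine Finset.sum_congr rfl fun F hF => ?_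
  have hF := (Finset.mem_filter.mp hF).2.2
  have : F.hook r = A.card + 1 := by
    rw [hook, ← Finset.card_insert_of_notMem hrA, ← Set.ncard_coe_finset]
    congr 1
    ext w
    simpa using hF w
  rw [this]
  push_cast
  rfl

end HookSum

theorem sum_hookWeight {K : Type*} [Field K] [CharZero K] (α : K) (n : ℕ) :
    ∀ {V : Type} [Fintype V], Fintype.card V = n → ∀ c : K,
      ∑ F : RootedForest V, hookWeight c α F = forestPoly n 1 (1 + α) (c * (1 + α)) := by
  induction n using Nat.strong_induction_on with
  | _ n ih =>
  intro V _ hcard c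
  classical
  cases n with
  | zero =>
    have : IsEmpty V := Fintype.card_eq_zero_iff.mp hcard
    let F₀ : RootedForest V := ⟨isEmptyElim, ⟨isEmptyElim⟩⟩
    have hF (F : RootedForest V) : F = F₀ := RootedForest.ext (funext isEmptyElim)
    rw [Finset.sum_eq_single_of_mem F₀ (Finset.mem_univ _) fun F _ h => absurd (hF F) h]
    simp [hookWeight, tree, Set.eq_empty_of_isEmpty]
  | succ m =>
    have hr (r : V) :
        ∑ F : RootedForest V with F.parent r = none, (F.hook r : K) * hookWeight c α F =
          forestPoly (m + 1) 1 (1 + α) (c * (1 + α)) := by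
      have hcard' : (Finset.univ.erase r).card = m := by
        rw [Finset.card_erase_of_mem (Finset.mem_univ r), Finset.card_univ, hcard]; rfl
      let f (k : ℕ) : K := c * ((k : K) + 1 + α) *
        (forestPoly k 1 (1 + α) (1 + α) * forestPoly (m - k) 1 (1 + α) (c * (1 + α)))
      rw [sum_root_hookWeight, forestPoly_recurrence,
        Finset.Nat.sum_antidiagonal_eq_sum_range_succ_mk]
      -- The summand depends on `A` only through its size, which produces the binomial coefficients.
      have key := Finset.sum_powerset_apply_card f (x := Finset.univ.erase r)
      rw [hcard'] at key
      simp only [nsmul_eq_mul] at key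
      refine Eq.trans (Finset.sum_congr rfl fun A hA => ?_) key
      have hA := Finset.mem_powerset.mp hA
      have hrA : r ∉ A := fun h => by simpa using hA h
      have hle : A.card ≤ m := hcard' ▸ Finset.card_le_card hA
      have hB : ((insert r A)ᶜ : Finset V).card = m - A.card := by
        rw [Finset.card_compl, Finset.card_insert_of_notMem hrA, hcard]; omega
      rw [ih A.card (by omega) (by simp), ih (m - A.card) (by omega) (by rw [Fintype.card_coe, hB])]
      have : (A.card : K) + 1 ≠ 0 := by exact_mod_cast A.card.succ_ne_zero
      simp only [f, one_mul]
      field_simp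
    have hne : ((m + 1 : ℕ) : K) ≠ 0 := by exact_mod_cast m.succ_ne_zero
    refine mul_left_cancel₀ hne ?_
    calc ((m + 1 : ℕ) : K) * ∑ F : RootedForest V, hookWeight c α F
        = ∑ F : RootedForest V, ∑ r : V,
            if F.parent r = none then (F.hook r : K) * hookWeight c α F else 0 := by
          rw [Finset.mul_sum]
          refine Finset.sum_congr rfl fun F _ => ?_
          rw [← hcard, ← sum_root_hook F, Nat.cast_sum, Finset.sum_mul]
          refine Finset.sum_congr rfl fun r _ => ?_
          split_ifs <;> simp
      _ = ∑ r : V, forestPoly (m + 1) 1 (1 + α) (c * (1 + α)) := by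
          rw [Finset.sum_comm]
          refine Finset.sum_congr rfl fun r _ => ?_
          rw [← Finset.sum_filter, hr]
      _ = ((m + 1 : ℕ) : K) * forestPoly (m + 1) 1 (1 + α) (c * (1 + α)) := by
          rw [Finset.sum_const, Finset.card_univ, hcard, nsmul_eq_mul]

end RootedForest

theorem mainTheorem3 {K : Type*} [Field K] [CharZero K] (n : ℕ) :
    (∀ c α : K,
      ∑ F : RootedForest (Fin n), c ^ F.tree * ∏ v : Fin n, (1 + α / (F.hook v : K)) =
        forestPoly n 1 (1 + α) (c * (1 + α))) ∧
    (∀ c : K, (n : K) + c ≠ 0 →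
      1 / (n.factorial : K) *
          ∑ F : RootedForest (Fin n), c ^ F.tree * ∏ v : Fin n, (1 + 1 / (F.hook v : K)) =
        1 / (n.factorial : K) * forestPoly n 1 2 (2 * c) ∧
      1 / (n.factorial : K) * forestPoly n 1 2 (2 * c) =
        c / ((n : K) + c) * Ring.choose (2 * (n : K) + 2 * c) n) ∧
    1 / (n.factorial : K) *
        ∑ F : RootedForest (Fin n), ∏ v : Fin n, (1 + 1 / (F.hook v : K)) =
      (catalan (n + 1) : K) := by
  have h1 (c α : K) :
      ∑ F : RootedForest (Fin n), c ^ F.tree * ∏ v : Fin n, (1 + α / (F.hook v : K)) =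
        forestPoly n 1 (1 + α) (c * (1 + α)) :=
    RootedForest.sum_hookWeight α n (Fintype.card_fin n) c
  have h2 (c : K) :
      ∑ F : RootedForest (Fin n), c ^ F.tree * ∏ v : Fin n, (1 + 1 / (F.hook v : K)) =
        forestPoly n 1 2 (2 * c) := by
    rw [h1, one_add_one_eq_two, mul_comm]
  refine ⟨h1, fun c hc => ⟨by rw [h2], forestPoly_one_two n hc⟩, ?_⟩
  have h3 := h2 1
  simp only [one_pow, one_mul] at h3
  rw [h3, forestPoly_one_two n (by exact_mod_cast n.succ_ne_zero), ← choose_div_eq_catalan,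
    show (2 * (n : K) + 2 * 1) = ((2 * n + 2 : ℕ) : K) by push_cast; ring, Ring.choose_natCast]
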